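/- \textbf{Model.} Fix an integer $\tau\ge 2$. There are $\ell$ objects with labels $T_1,\dots,T_\ell$ drawn i.i.d. from an unknown prior $P_T$ on $[\tau]=\{1,\dots,\tau\}$. Responses take values in $\mathcal Y=[\tau]\cup\{\xi\}$, where $\xi$ is a null response. For a label sequence $t\in[\tau]^\ell$ let $\tilde\imath=\max\{k<i: t_k=t_i\}$ (if such $k$ exists) and let $\mathcal N_i$ be the set consisting of $i-1$ (if $i>1$) and $\tilde\imath$ (if it exists). A \emph{worker pool} is a family $Q$ of probability mass functions on $\mathcal Y$, where $Q(\cdot\mid y_{i-1},y_{\tilde\imath},t_i)$ is the law of the response to an object of class $t_i$ given the most recent response and the response to the most recent object of the same class (each of the two arguments may be absent). Given $T^\ell=t$, each of $n$ workers, independently of the others, responds to the $\ell$ objects with law $\Pr(Y^\ell=y)=\prod_{i=1}^{\ell}Q(y_i\mid y_{i-1},y_{\tilde\imath},t_i)$, which gives the response matrix $\mathbf Y\in\mathcal Y^{\ell\times n}$. \textbf{Memory quality.} For a label sequence $t$ with some repeated label put \[ \theta(t)=\tfrac12\Bigl(\min_{i} I(Y_i;Y_{\mathcal N_i})-\max_{i,j}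 I(Y_i;Y_{i-1},Y_j)\Bigr), \] with mutual informations (in nats) under the response law given $T^\ell=t$. The minimum is over the $i$ for which $\tilde\imath$ exists. The maximum is over the $i$ for which $\tilde\imath$ exists and $\tilde\imath\ne i-1$, and over $j<i$ with $j\notin\mathcal N_i$; it is $0$ if there is no such pair. The memory quality $\theta_m$ of the pool for $\ell\ge2$ objects is the minimum of $\theta(t)$ over all $t\in[\tau]^\ell$ with a repeated label. \textbf{Sample complexity.} A decoder with $n$ responses per object is a map $\Phi$ from $\mathcal Y^{\ell\times n}$ to the partitions of $[\ell]$. Its error probability $P_e(\Phi)$ is the probability that $\Phi(\mathbf Y)$ differs from the partition of $[\ell]$ according to the labels. Let $\mathcal W$ be a set of worker pools. Let $N^*_{\mathrm{mem}}(\epsilon;\ell,\theta_m)\in\mathbb N\cup\{\infty\}$ be the least $n$ for which there is a decoder $\Phi$ such that $P_e(\Phi)<\epsilon$ for every prior $P_T$ and every pool in $\mathcal W$ whose memory quality for $\ell$ objects is exactly $\theta_m$. The main case is that $\mathcal W$ is the set of all worker pools. More generally, $\mathcal W$ may be any set of pools that contains all pools for which $Q$ does not depend on $y_{i-1}$. Call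 $\theta_m>0$ \emph{nondegenerate} if there is $\delta>0$ such that for all sufficiently large $\ell$ some pool in $\mathcal W$ has all its probabilities $Q(y\mid\cdot)$ at least $\delta$ and has memory quality $\theta_m$ for $\ell$ objects. \textbf{Theorem.} \begin{enumerate} \item There is $\theta_0>0$ such that all $\theta_m\in(0,\theta_0)$ are nondegenerate. For every fixed nondegenerate $\theta_m>0$ and every $\epsilon\in(0,1)$, $N^*_{\mathrm{mem}}(\epsilon;\ell,\theta_m)=\Omega(\log\ell)$ as $\ell\to\infty$. \item For every fixed $\ell\ge2$ and every $\epsilon\in(0,\tfrac12)$, $N^*_{\mathrm{mem}}(\epsilon;\ell,\theta_m)=\Omega(\theta_m^{-1})$ as $\theta_m\to0^+$. \end{enumerate} The constants in $\Omega$ may depend on $\tau$, on $\epsilon$ and on the parameter that is held fixed. -/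

import Mathlib

open Filter Topology
open scoped ENNReal

noncomputable section

namespace CrowdMemory

/-- The response alphabet: a class in `[τ]`, or the null response (`none`). -/
abbrev Resp (τ : ℕ) : Type := Option (Fin τ)

/-- A Markov memory worker model: `Q t a b` is the law of the response to an object of class `t`,
where `a` is the most recent response (`none` for the very first object) and `b` is the response to
the most recent object of the same class (`none` if there is no such object).
Points of the standard simplex are probability mass functions. -/
abbrev WorkerModel (τ : ℕ) : Type :=
  Fin τ → Option (Resp τ) → Option (Resp τ) → stdSimplex ℝ (Resp τ)

section Model

variable {τ ℓ : ℕ}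

/-- The largest element of a finite set of indices, if there is one. -/
def last? (s : Finset (Fin ℓ)) : Option (Fin ℓ) :=
  if h : s.Nonempty then some (s.max' h) else none

/-- The object preceding `i`. -/
def prev (i : Fin ℓ) : Option (Fin ℓ) := last? (Finset.Iio i)

/-- The most recent object before `i` that is of the same class as `i`. -/
def prevSame (t : Fin ℓ → Fin τ) (i : Fin ℓ) : Option (Fin ℓ) :=
  last? ((Finset.Iio i).filter fun k => t k = t i)

/-- The neighbours of `i`: the preceding object and the most recent one of the same class. -/
def neighbors (t : Fin ℓ → Fin τ) (i : Fin ℓ) : Finset (Fin ℓ) :=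
  (prev i).toFinset ∪ (prevSame t i).toFinset

/-- Probability that one worker gives the responses `y` to objects with labels `t`. -/
def respProb (Q : WorkerModel τ) (t : Fin ℓ → Fin τ) (y : Fin ℓ → Resp τ) : ℝ :=
  ∏ i, (Q (t i) ((prev i).map y) ((prevSame t i).map y)).1 (y i)

/-- Mutual information (in nats) of a joint probability mass function. -/
def mutualInfo {α β : Type*} [Fintype α] [Fintype β] (p : α → β → ℝ) : ℝ :=
  ∑ a, ∑ b, p a b * Real.log (p a b / ((∑ b', p a b') * ∑ a', p a' b))

/-- Joint law of `Y i` and `(Y k)_{k ∈ S}` when the labels are `t`. -/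
def pairLaw (Q : WorkerModel τ) (t : Fin ℓ → Fin τ) (i : Fin ℓ) (S : Finset (Fin ℓ))
    (a : Resp τ) (b : S → Resp τ) : ℝ :=
  ∑ y : Fin ℓ → Resp τ with y i = a ∧ ∀ k : S, y k = b k, respProb Q t y

/-- `I(Y_i ; Y_S)` when the labels are `t`. -/
def info (Q : WorkerModel τ) (t : Fin ℓ → Fin τ) (i : Fin ℓ) (S : Finset (Fin ℓ)) : ℝ :=
  mutualInfo (pairLaw Q t i S)

/-- Memory quality for the labels `t`: half of
`min_i I(Y_i ; Y_{N_i}) - max_{i,j} I(Y_i ; Y_{i-1}, Y_j)`. Here `i` has an earlier object of its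
own class, `j < i` is not a neighbour of `i`, and in the maximum the most recent object of the class
of `i` is not `i - 1` (otherwise `{i - 1, j}` contains all neighbours of `i`, so it carries exactly
the information of the neighbours). The maximum over no pair is `0`. -/
def labelQuality (Q : WorkerModel τ) (t : Fin ℓ → Fin τ) : ℝ :=
  (1 / 2) *
    ((⨅ i : {i : Fin ℓ // prevSame t i ≠ none}, info Q t i (neighbors t i)) -
      ⨆ p : {p : Fin ℓ × Fin ℓ // prevSame t p.1 ≠ none ∧ prevSame t p.1 ≠ prev p.1 ∧
          p.2 < p.1 ∧ p.2 ∉ neighbors t p.1},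
        info Q t p.1.1 (insert p.1.2 (prev p.1.1).toFinset))

/-- Memory quality of a worker pool for `ℓ ≥ 2` objects: the worst case over all label sequences in
which some class is repeated (for the others there is no memory to measure). -/
def memoryQuality (Q : WorkerModel τ) (ℓ : ℕ) : ℝ :=
  ⨅ t : {t : Fin ℓ → Fin τ // ¬ Function.Injective t}, labelQuality Q t.1

/-- A decoder with `n` responses per object. Partitions of `[ℓ]` are given as equivalence
relations. -/
abbrev Decoder (τ ℓ n : ℕ) : Type := (Fin ℓ → Fin n → Resp τ) → Setoid (Fin ℓ)

open Classical in
/-- Probability that the decoder misses the correct clustering `Setoid.ker t`, when the labels are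
i.i.d. with law `P` and, given the labels, `n` workers respond independently. -/
def errorProb {n : ℕ} (Q : WorkerModel τ) (P : stdSimplex ℝ (Fin τ)) (Φ : Decoder τ ℓ n) : ℝ :=
  ∑ t : Fin ℓ → Fin τ, (∏ i, P.1 (t i)) *
    ∑ Y : Fin ℓ → Fin n → Resp τ, (∏ j, respProb Q t fun i => Y i j) *
      if Φ Y = Setoid.ker t then 0 else 1

end Model

/-- Sample complexity: the least number `n` of responses per object for which one decoder, knowing
neither the prior nor the worker pool, has error probability below `ε` for every prior and every
pool from `𝒲` of memory quality `θ`; it is `⊤` if there is no such `n`. -/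
def sampleComplexity {τ : ℕ} (𝒲 : Set (WorkerModel τ)) (ℓ : ℕ) (θ ε : ℝ) : ℕ∞ :=
  ⨅ (n : ℕ) (_ : ∃ Φ : Decoder τ ℓ n, ∀ Q ∈ 𝒲, memoryQuality Q ℓ = θ →
    ∀ P : stdSimplex ℝ (Fin τ), errorProb Q P Φ < ε), (n : ℕ∞)

/-- Worker models in which a response depends on earlier ones only through the most recent object of
the same class. -/
def ownClassModels (τ : ℕ) : Set (WorkerModel τ) :=
  {Q | ∀ t a a' b, Q t a b = Q t a' b}

/-- The memory qualities that are attained, for all large `ℓ`, by pools from `𝒲` whose response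
probabilities are bounded away from `0`. -/
def noisyQualities {τ : ℕ} (𝒲 : Set (WorkerModel τ)) : Set ℝ :=
  {θ | ∃ δ > 0, ∀ᶠ ℓ : ℕ in atTop, ∃ Q ∈ 𝒲, (∀ t a b y, δ ≤ (Q t a b).1 y) ∧
    memoryQuality Q ℓ = θ}

end CrowdMemory

end

/-!
Both bounds are obtained from explicit pools and the prior that picks one of two classes with equal
probability.

The pools use a memory of depth one (`MemoryPattern`): the response to an object is drawn from the
uniform law, perturbed by `s * cue b * echo a`, where `b` is the previous response of the same class.
Since `cue` is orthogonal to constants and to `echo`, every response is uniform, and the response to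
`i` is independent of any set of earlier responses that does not contain the previous one of its
class. So all the informations in the maximum of the memory quality vanish, all those in the minimum
are one and the same function `pairInfo s` of the strength `s`, and the memory quality is exactly
`pairInfo s / 2` for every number of objects (`memoryQuality_pool`). The function `pairInfo` is
continuous, vanishes at `0` and is bounded below by a multiple of `s ^ 2`. By the intermediate value
theorem it takes all small values, with response probabilities bounded away from zero.

For many objects, suppose that all response probabilities are at least `δ`. Changing the label of one
object changes the response law of at most three objects, hence the likelihood of the data by a
factor of at least `δ ^ (3 * n)`. The true labelling therefore competes with its `ℓ` single flips,
and a decoder is right with probability at most `τ / (ℓ * δ ^ (3 * n))`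
(`mul_one_sub_errorProb_le`), which tends to zero if `n` is a small multiple of `log ℓ`.

For weak memory, a pool of quality `θ` has `s ^ 2` of order `θ`. The `χ²` divergence of the law of
one worker's responses from the uniform law is of order `s ^ 2`, and `1 + χ²` is multiplicative over
the workers. If `n * θ` is small, the data thus look almost the same for all labellings, and since
no clustering has prior probability above one half, the error probability is close to at least one
half (`exists_half_sub_le_errorProb`).
-/

noncomputable section

namespace CrowdMemory

/-! ### Summing out a coordinate -/

theorem sum_eq_sum_of_sum_update {ι β : Type*} [Fintype ι] [DecidableEq ι] [Fintype β] [Nonempty β]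
    (i : ι) {F G : (ι → β) → ℝ}
    (h : ∀ y, ∑ v, F (Function.update y i v) = ∑ v, G (Function.update y i v)) :
    ∑ y, F y = ∑ y, G y := by
  classical
  have key : ∀ F : (ι → β) → ℝ, ∑ y, F y =
      ∑ z : {j // j ≠ i} → β, ∑ v, F (Function.update
        ((Equiv.funSplitAt i β).symm (Classical.arbitrary β, z)) i v) := by
    intro F
    rw [← (Equiv.funSplitAt i β).symm.sum_comp, Fintype.sum_prod_type_right]
    refine Finset.sum_congr rfl fun z _ => Finset.sum_congr rfl fun v _ => congrArg F ?_
    ext j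
    by_cases hj : j = i
    · subst hj; simp [Equiv.funSplitAt, Equiv.piSplitAt]
    · simp [Equiv.funSplitAt, Equiv.piSplitAt, hj]
  rw [key F, key G]
  exact Finset.sum_congr rfl fun z _ => h _

/-- Two weighted sums over all words agree if the weights differ only in the factor of the letter
`i`, no other factor depends on that letter, and the sums over that letter alone agree. -/
theorem sum_prod_mul_congr {ι β : Type*} [Fintype ι] [DecidableEq ι] [Fintype β] [Nonempty β]
    (i : ι) {w w' : ι → (ι → β) → ℝ} {F F' : (ι → β) → ℝ}
    (hw : ∀ k ≠ i, w k = w' k) (hk : ∀ k ≠ i, ∀ y v, w k (Function.update y i v) = w k y)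
    (h : ∀ y, ∑ v, w i (Function.update y i v) * F (Function.update y i v) =
      ∑ v, w' i (Function.update y i v) * F' (Function.update y i v)) :
    ∑ y, (∏ k, w k y) * F y = ∑ y, (∏ k, w' k y) * F' y := by
  classical
  refine sum_eq_sum_of_sum_update i fun y => ?_
  have h1 : ∀ v, (∏ k, w k (Function.update y i v)) =
      (∏ k ∈ Finset.univ.erase i, w k y) * w i (Function.update y i v) := by
    intro v
    rw [← Finset.prod_erase_mul _ _ (Finset.mem_univ i)]
    congr 1
    exact Finset.prod_congr rfl fun k hk' => hk k (Finset.ne_of_mem_erase hk') y v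
  have h2 : ∀ v, (∏ k, w' k (Function.update y i v)) =
      (∏ k ∈ Finset.univ.erase i, w k y) * w' i (Function.update y i v) := by
    intro v
    rw [← Finset.prod_erase_mul _ _ (Finset.mem_univ i)]
    congr 1
    refine Finset.prod_congr rfl fun k hk' => ?_
    rw [← hw k (Finset.ne_of_mem_erase hk'), hk k (Finset.ne_of_mem_erase hk') y v]
  simp only [h1, h2, mul_assoc]
  rw [← Finset.mul_sum, ← Finset.mul_sum, h y]

/-! ### Predecessors -/

section Predecessors

variable {τ ℓ : ℕ}

theorem last?_eq_some_iff {s : Finset (Fin ℓ)} {p : Fin ℓ} :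
    last? s = some p ↔ p ∈ s ∧ ∀ k ∈ s, k ≤ p := by
  unfold last?
  split_ifs with h
  · rw [Option.some_inj, Finset.max'_eq_iff]
  · simp only [false_iff]
    exact fun hp => h ⟨p, hp.1⟩

theorem last?_eq_none_iff {s : Finset (Fin ℓ)} : last? s = none ↔ s = ∅ := by
  unfold last?
  split_ifs with h
  · simp [h.ne_empty]
  · simpa using h

theorem lt_of_prev_eq_some {i p : Fin ℓ} (h : prev i = some p) : p < i :=
  Finset.mem_Iio.1 (last?_eq_some_iff.1 h).1

theorem prevSame_eq_some_iff {t : Fin ℓ → Fin τ} {i p : Fin ℓ} :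
    prevSame t i = some p ↔ p < i ∧ t p = t i ∧ ∀ k < i, t k = t i → k ≤ p := by
  simp only [prevSame, last?_eq_some_iff, Finset.mem_filter, Finset.mem_Iio, and_assoc, and_imp]

theorem prevSame_eq_none_iff {t : Fin ℓ → Fin τ} {i : Fin ℓ} :
    prevSame t i = none ↔ ∀ k < i, t k ≠ t i := by
  simp [prevSame, last?_eq_none_iff, Finset.filter_eq_empty_iff]

theorem lt_of_prevSame_eq_some {t : Fin ℓ → Fin τ} {i p : Fin ℓ} (h : prevSame t i = some p) :
    p < i := (prevSame_eq_some_iff.1 h).1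

theorem prevSame_injective {t : Fin ℓ → Fin τ} {i i' p : Fin ℓ} (h : prevSame t i = some p)
    (h' : prevSame t i' = some p) : i = i' := by
  obtain ⟨h1, h2, h3⟩ := prevSame_eq_some_iff.1 h
  obtain ⟨h1', h2', h3'⟩ := prevSame_eq_some_iff.1 h'
  rcases lt_trichotomy i i' with hlt | heq | hlt
  · exact absurd (h3' i hlt (h2.symm.trans h2')) (not_le.2 h1)
  · exact heq
  · exact absurd (h3 i' hlt (h2'.symm.trans h2)) (not_le.2 h1')

theorem map_update_of_ne {β : Type*} {o : Option (Fin ℓ)} {k : Fin ℓ} (h : o ≠ some k)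
    (y : Fin ℓ → β) (v : β) : o.map (Function.update y k v) = o.map y := by
  cases o with
  | none => rfl
  | some p =>
    have : p ≠ k := fun hp => h (congrArg some hp)
    simp [this]

end Predecessors

/-! ### Expectations under the response law -/

section Expectation

variable {τ ℓ : ℕ}

/-- The mass of a point under the uniform law on the `τ + 1` responses. -/
def unifMass (τ : ℕ) : ℝ := ((τ : ℝ) + 1)⁻¹

theorem unifMass_pos : 0 < unifMass τ := by unfold unifMass; positivity

theorem unifMass_le_one : unifMass τ ≤ 1 := by
  unfold unifMass
  exact inv_le_one_of_one_le₀ (by have : (0 : ℝ) ≤ τ := by positivity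
                                  linarith)

theorem sum_unifMass : ∑ _v : Resp τ, unifMass τ = 1 := by
  have : ((τ : ℝ) + 1) ≠ 0 := by positivity
  simp [unifMass, Resp, this]

/-- The law of the response to object `i` when the earlier responses are those of `y`. -/
def stepLaw (Q : WorkerModel τ) (t : Fin ℓ → Fin τ) (i : Fin ℓ) (y : Fin ℓ → Resp τ) :
    Resp τ → ℝ :=
  (Q (t i) ((prev i).map y) ((prevSame t i).map y)).1

theorem sum_stepLaw (Q : WorkerModel τ) (t : Fin ℓ → Fin τ) (i : Fin ℓ) (y : Fin ℓ → Resp τ) :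
    ∑ a, stepLaw Q t i y a = 1 := (Q _ _ _).2.2

theorem stepLaw_nonneg (Q : WorkerModel τ) (t : Fin ℓ → Fin τ) (i : Fin ℓ) (y : Fin ℓ → Resp τ)
    (a : Resp τ) : 0 ≤ stepLaw Q t i y a := (Q _ _ _).2.1 a

theorem stepLaw_le_one (Q : WorkerModel τ) (t : Fin ℓ → Fin τ) (i : Fin ℓ) (y : Fin ℓ → Resp τ)
    (a : Resp τ) : stepLaw Q t i y a ≤ 1 := by
  rw [← sum_stepLaw Q t i y]
  exact Finset.single_le_sum (fun b _ => stepLaw_nonneg Q t i y b) (Finset.mem_univ a)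

theorem stepLaw_update (Q : WorkerModel τ) (t : Fin ℓ → Fin τ) {i k : Fin ℓ} (h : i ≤ k)
    (y : Fin ℓ → Resp τ) (v : Resp τ) :
    stepLaw Q t i (Function.update y k v) = stepLaw Q t i y := by
  unfold stepLaw
  rw [map_update_of_ne (fun hp => absurd (lt_of_prev_eq_some hp) (not_lt.2 h)),
    map_update_of_ne (fun hp => absurd (lt_of_prevSame_eq_some hp) (not_lt.2 h))]

theorem respProb_nonneg (Q : WorkerModel τ) (t : Fin ℓ → Fin τ) (y : Fin ℓ → Resp τ) :
    0 ≤ respProb Q t y :=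
  Finset.prod_nonneg fun i _ => stepLaw_nonneg Q t i y (y i)

/-- Expectation of `φ` under the law of the responses of one worker. -/
def expect (Q : WorkerModel τ) (t : Fin ℓ → Fin τ) (φ : (Fin ℓ → Resp τ) → ℝ) : ℝ :=
  ∑ y, respProb Q t y * φ y

/-- `φ` is a function of the letters before position `n` only. -/
def DependsBelow (n : ℕ) (φ : (Fin ℓ → Resp τ) → ℝ) : Prop :=
  ∀ k : Fin ℓ, n ≤ k → ∀ y v, φ (Function.update y k v) = φ y

/-- In the expectation of a function of the responses before position `n`, all later responses may
be replaced by independent uniform ones: summing out the responses from the last one down removes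
one factor at a time. -/
theorem expect_eq_truncated (Q : WorkerModel τ) (t : Fin ℓ → Fin τ) {n : ℕ}
    {φ : (Fin ℓ → Resp τ) → ℝ} (hφ : DependsBelow n φ) :
    expect Q t φ = ∑ y, (∏ k : Fin ℓ, if (k : ℕ) < n then stepLaw Q t k y (y k) else unifMass τ) *
      φ y := by
  have step : ∀ m, n ≤ m →
      ∑ y, (∏ k : Fin ℓ, if (k : ℕ) < m then stepLaw Q t k y (y k) else unifMass τ) * φ y =
      ∑ y, (∏ k : Fin ℓ, if (k : ℕ) < n then stepLaw Q t k y (y k) else unifMass τ) * φ y := by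
    intro m hm
    induction m, hm using Nat.le_induction with
    | base => rfl
    | succ m hm ih =>
      rw [← ih]
      by_cases hmℓ : m < ℓ
      · refine sum_prod_mul_congr ⟨m, hmℓ⟩
          (w := fun (k : Fin ℓ) y => if (k : ℕ) < m + 1 then stepLaw Q t k y (y k) else unifMass τ)
          (w' := fun (k : Fin ℓ) y => if (k : ℕ) < m then stepLaw Q t k y (y k) else unifMass τ)
          ?_ ?_ ?_
        · intro k hk
          have : (k : ℕ) ≠ m := fun h => hk (Fin.ext h)
          have h' : ((k : ℕ) < m + 1) ↔ (k : ℕ) < m := by omega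
          simp only [h']
        · intro k hk y v
          have : (k : ℕ) ≠ m := fun h => hk (Fin.ext h)
          by_cases hkm : (k : ℕ) < m + 1
          · simp only [hkm, if_true]
            rw [stepLaw_update Q t (k := ⟨m, hmℓ⟩) (Fin.le_def.2 (by simp; omega)),
              Function.update_of_ne hk]
          · simp only [hkm, if_false]
        · intro y
          simp only [hφ ⟨m, hmℓ⟩ hm, lt_add_iff_pos_right, if_true, lt_irrefl,
            if_false, stepLaw_update Q t le_rfl, Function.update_self, zero_lt_one]
          rw [← Finset.sum_mul, ← Finset.sum_mul, sum_stepLaw, sum_unifMass]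
      · refine Finset.sum_congr rfl fun y _ => congrArg (· * φ y) (Finset.prod_congr rfl ?_)
        intro k _
        have := k.2
        rw [if_pos (by omega), if_pos (by omega)]
  rw [← step (max n ℓ) (le_max_left _ _)]
  refine Finset.sum_congr rfl fun y _ => congrArg (· * φ y) (Finset.prod_congr rfl ?_)
  intro k _
  rw [if_pos (lt_of_lt_of_le k.2 (le_max_right _ _))]
  rfl

theorem expect_one (Q : WorkerModel τ) (t : Fin ℓ → Fin τ) : expect Q t (fun _ => 1) = 1 := by
  rw [expect_eq_truncated Q t (n := 0) (fun _ _ _ _ => rfl)]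
  have h : ((τ : ℝ) + 1) ≠ 0 := by positivity
  simp [unifMass, Resp, h]

theorem sum_respProb (Q : WorkerModel τ) (t : Fin ℓ → Fin τ) : ∑ y, respProb Q t y = 1 := by
  simpa [expect] using expect_one Q t

theorem expect_sum {α : Type*} (s : Finset α) (Q : WorkerModel τ) (t : Fin ℓ → Fin τ)
    (φ : α → (Fin ℓ → Resp τ) → ℝ) :
    expect Q t (fun y => ∑ a ∈ s, φ a y) = ∑ a ∈ s, expect Q t (φ a) := by
  simp only [expect, Finset.mul_sum]
  exact Finset.sum_comm

theorem expect_mul_left (Q : WorkerModel τ) (t : Fin ℓ → Fin τ) (c : ℝ)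
    (φ : (Fin ℓ → Resp τ) → ℝ) : expect Q t (fun y => c * φ y) = c * expect Q t φ := by
  simp only [expect, Finset.mul_sum]
  exact Finset.sum_congr rfl fun y _ => by ring

theorem expect_add (Q : WorkerModel τ) (t : Fin ℓ → Fin τ)
    (φ ψ : (Fin ℓ → Resp τ) → ℝ) :
    expect Q t (fun y => φ y + ψ y) = expect Q t φ + expect Q t ψ := by
  simp only [expect, mul_add, Finset.sum_add_distrib]

/-- Given the earlier responses, the response to object `i` has law `stepLaw Q t i`. -/
theorem expect_indicator_mul (Q : WorkerModel τ) (t : Fin ℓ → Fin τ) (i : Fin ℓ) (a : Resp τ)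
    {φ : (Fin ℓ → Resp τ) → ℝ} (hφ : DependsBelow i φ) :
    expect Q t (fun y => (if y i = a then 1 else 0) * φ y) =
      expect Q t (fun y => stepLaw Q t i y a * φ y) := by
  rw [expect_eq_truncated Q t (n := i + 1), expect_eq_truncated Q t (n := i + 1)]
  · refine sum_prod_mul_congr i
      (w := fun (k : Fin ℓ) y => if (k : ℕ) < i + 1 then stepLaw Q t k y (y k) else unifMass τ)
      (fun _ _ => rfl) ?_ ?_
    · intro k hk y v
      by_cases hki : (k : ℕ) < i + 1
      · simp only [hki, if_true]
        rw [stepLaw_update Q t (Fin.le_def.2 (by omega)), Function.update_of_ne hk]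
      · simp only [hki, if_false]
    · intro y
      simp only [hφ i le_rfl, stepLaw_update Q t le_rfl, Function.update_self,
        lt_add_iff_pos_right, zero_lt_one, if_true]
      rw [← Finset.sum_mul, sum_stepLaw]
      simp [ite_mul, mul_ite]
  · intro k hk y v
    have hik : i < k := Fin.lt_def.2 (by omega)
    simp only [stepLaw_update Q t hik.le, hφ k (by omega)]
  · intro k hk y v
    have hik : i ≠ k := by rintro rfl; omega
    simp only [Function.update_of_ne hik, hφ k (by omega)]

end Expectation

/-! ### Mutual information -/

theorem mutualInfo_eq_zero_of_product {α β : Type*} [Fintype α] [Fintype β] {p : α → ℝ}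
    {q : β → ℝ} (hp : ∑ a, p a = 1) (hq : ∑ b, q b = 1) :
    mutualInfo (fun a b => p a * q b) = 0 := by
  refine Finset.sum_eq_zero fun a _ => Finset.sum_eq_zero fun b _ => ?_
  rw [← Finset.mul_sum, ← Finset.sum_mul, hp, hq, mul_one, one_mul]
  rcases eq_or_ne (p a * q b) 0 with h | h
  · simp [h]
  · simp [div_self h]

/-- A pointwise lower bound for the integrand of the relative entropy. It comes from
`log x ≤ x - 1` at `x = √(q / p)`, which bounds relative entropy by squared Hellinger distance. -/
theorem sub_add_sq_le_mul_log_div {p q : ℝ} (hp : 0 < p) (hp1 : p ≤ 1) (hq : 0 < q) (hq1 : q ≤ 1) :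
    p - q + (p - q) ^ 2 / 4 ≤ p * Real.log (p / q) := by
  have ha : 0 < √p := Real.sqrt_pos.2 hp
  have hb : 0 < √q := Real.sqrt_pos.2 hq
  have ha1 : √p ≤ 1 := Real.sqrt_le_one.2 hp1
  have hb1 : √q ≤ 1 := Real.sqrt_le_one.2 hq1
  have hpa : p = √p ^ 2 := (Real.sq_sqrt hp.le).symm
  have hqb : q = √q ^ 2 := (Real.sq_sqrt hq.le).symm
  generalize √p = a at *
  generalize √q = b at *
  subst hpa hqb
  have hlog : Real.log (a ^ 2 / b ^ 2) = -2 * Real.log (b / a) := by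
    rw [← div_pow, Real.log_pow, Real.log_div ha.ne' hb.ne', Real.log_div hb.ne' ha.ne']
    push_cast
    ring
  have h1 : Real.log (b / a) ≤ b / a - 1 := Real.log_le_sub_one_of_pos (div_pos hb ha)
  have h2 : a ^ 2 * (b / a) = a * b := by field_simp
  have h3 : 2 * a ^ 2 - 2 * (a * b) ≤ a ^ 2 * Real.log (a ^ 2 / b ^ 2) := by
    rw [hlog, ← h2]
    nlinarith [sq_nonneg a]
  have h4 : (a + b) ^ 2 ≤ 4 := by nlinarith
  nlinarith [mul_le_mul_of_nonneg_left h4 (sq_nonneg (a - b))]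

section PairLaw

variable {τ ℓ : ℕ}

/-- Indicator of the event that the responses in `S` are those of `b`. -/
def matchInd (S : Finset (Fin ℓ)) (b : S → Resp τ) (y : Fin ℓ → Resp τ) : ℝ :=
  if ∀ k : S, y k = b k then 1 else 0

theorem pairLaw_eq_expect (Q : WorkerModel τ) (t : Fin ℓ → Fin τ) (i : Fin ℓ) (S : Finset (Fin ℓ))
    (a : Resp τ) (b : S → Resp τ) :
    pairLaw Q t i S a b = expect Q t (fun y => (if y i = a then 1 else 0) * matchInd S b y) := by
  rw [pairLaw, Finset.sum_filter]
  refine Finset.sum_congr rfl fun y _ => ?_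
  by_cases h1 : y i = a <;> by_cases h2 : ∀ k : S, y k = b k <;> simp [matchInd, h1, h2]

theorem dependsBelow_matchInd {i : Fin ℓ} {S : Finset (Fin ℓ)} (hS : ∀ k ∈ S, k < i)
    (b : S → Resp τ) : DependsBelow i (matchInd S b) := by
  intro k hk y v
  have : ∀ j : S, Function.update y k v j = y j := fun j =>
    Function.update_of_ne (fun h => absurd (hS j j.2) (by rw [h]; exact not_lt.2 (Fin.le_def.2 hk)))
      _ _
  simp only [matchInd, this]

theorem matchInd_update {p : Fin ℓ} {S : Finset (Fin ℓ)} (hp : p ∉ S) (b : S → Resp τ)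
    (y : Fin ℓ → Resp τ) (v : Resp τ) : matchInd S b (Function.update y p v) = matchInd S b y := by
  have : ∀ j : S, Function.update y p v j = y j := by
    rintro ⟨j, hj⟩
    exact Function.update_of_ne (by rintro rfl; exact hp hj) _ _
  simp only [matchInd, this]

/-- Expectations of functions of `Y_S`, from the law of `Y_S`. -/
theorem sum_expect_matchInd_mul (Q : WorkerModel τ) (t : Fin ℓ → Fin τ) (S : Finset (Fin ℓ))
    (h : (S → Resp τ) → ℝ) :
    ∑ b, expect Q t (matchInd S b) * h b = expect Q t (fun y => h fun k => y k) := by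
  have : ∀ b, expect Q t (matchInd S b) * h b = expect Q t (fun y => h b * matchInd S b y) :=
    fun b => by rw [expect_mul_left, mul_comm]
  simp only [this, ← expect_sum]
  congr 1
  ext y
  rw [Finset.sum_eq_single fun k : S => y k]
  · simp [matchInd]
  · intro b _ hb
    rw [matchInd, if_neg, mul_zero]
    exact fun h => hb (funext fun k => (h k).symm)
  · simp

theorem sum_expect_matchInd (Q : WorkerModel τ) (t : Fin ℓ → Fin τ) (S : Finset (Fin ℓ)) :
    ∑ b, expect Q t (matchInd S b) = 1 := by
  simpa [expect_one] using sum_expect_matchInd_mul Q t S fun _ => 1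

end PairLaw

/-! ### Pools whose memory reaches back exactly one object -/

/-- A pair of functions `cue` and `echo` on the responses such that the rows and the columns of the
matrix `(b, a) ↦ cue b * echo a` sum to zero and the matrix squares to zero. Added to the uniform
kernel with a small weight, it yields a response that depends on the previous response of the class,
but not on the one before that, and keeps the uniform law stationary. The bounds by `1` ensure that
a small weight leaves all probabilities positive. -/
structure MemoryPattern (τ : ℕ) where
  /-- What is remembered of a response. -/
  cue : Resp τ → ℝ
  /-- How the memory shifts the law of the next response. -/
  echo : Resp τ → ℝ
  sum_cue : ∑ a, cue a = 0
  sum_echo : ∑ a, echo a = 0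
  sum_cue_mul_echo : ∑ a, cue a * echo a = 0
  abs_cue_le : ∀ a, |cue a| ≤ 1
  abs_echo_le : ∀ a, |echo a| ≤ 1
  cue_ne_zero : cue ≠ 0
  echo_ne_zero : echo ≠ 0

/-- Two classes and the null response give the three responses that a pattern needs. -/
theorem nonempty_memoryPattern {τ : ℕ} (hτ : 2 ≤ τ) : Nonempty (MemoryPattern τ) := by
  let x : Fin τ := ⟨0, by omega⟩
  let x' : Fin τ := ⟨1, by omega⟩
  have hx : x' ≠ x := by simp [x, x', Fin.ext_iff]
  have ite_abs : ∀ (P P' : Prop) [Decidable P] [Decidable P'] (c c' : ℝ), ¬ (P ∧ P') → |c| ≤ 1 →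
      |c'| ≤ 1 → |(if P then c else 0) + (if P' then c' else 0)| ≤ 1 := by
    intro P P' _ _ c c' h hc hc'
    by_cases h1 : P <;> by_cases h2 : P' <;> simp_all
  refine ⟨{
    cue := fun a => a.elim 0 fun y => (if y = x then 1 else 0) + (if y = x' then -1 else 0)
    echo := fun a => a.elim (-1) fun y =>
      (if y = x then 1 / 2 else 0) + (if y = x' then 1 / 2 else 0)
    sum_cue := ?_
    sum_echo := ?_
    sum_cue_mul_echo := ?_
    abs_cue_le := ?_
    abs_echo_le := ?_
    cue_ne_zero := ?_
    echo_ne_zero := ?_ }⟩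
  · simp [Fintype.sum_option, Finset.sum_add_distrib]
  · simp [Fintype.sum_option, Finset.sum_add_distrib]
    norm_num
  · simp [Fintype.sum_option, Finset.sum_add_distrib, add_mul, hx, hx.symm]
  · rintro (_ | y)
    · simp
    · refine ite_abs _ _ _ _ (fun h => hx (h.2.symm.trans h.1)) ?_ ?_ <;> norm_num
  · rintro (_ | y)
    · simp
    · refine ite_abs _ _ _ _ (fun h => hx (h.2.symm.trans h.1)) ?_ ?_ <;> norm_num [abs_le]
  · intro h
    simpa [hx.symm] using congrFun h (some x)
  · intro h
    simpa using congrFun h none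

namespace MemoryPattern

variable {τ ℓ : ℕ} (p : MemoryPattern τ) {s : ℝ}

/-- The response law after the response `b` of the same class: the uniform law, perturbed with
strength `s`. -/
def kernel (s : ℝ) (b : Option (Resp τ)) (a : Resp τ) : ℝ :=
  unifMass τ + s * b.elim 0 p.cue * p.echo a

theorem abs_perturbation_le (hs : 0 ≤ s) (b : Option (Resp τ)) (a : Resp τ) :
    |s * b.elim 0 p.cue * p.echo a| ≤ s := by
  have h : |b.elim 0 p.cue| ≤ 1 := by
    cases b with
    | none => simp
    | some r => exact p.abs_cue_le r
  rw [abs_mul, abs_mul, abs_of_nonneg hs, mul_assoc]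
  exact mul_le_of_le_one_right hs (mul_le_one₀ h (abs_nonneg _) (p.abs_echo_le a))

theorem half_unifMass_le_kernel (hs : s ∈ Set.Icc 0 (unifMass τ / 2)) (b : Option (Resp τ))
    (a : Resp τ) : unifMass τ / 2 ≤ p.kernel s b a := by
  have := (abs_le.1 (p.abs_perturbation_le hs.1 b a)).1
  unfold kernel
  linarith [hs.2]

theorem sum_kernel (s : ℝ) (b : Option (Resp τ)) : ∑ a, p.kernel s b a = 1 := by
  simp only [kernel, Finset.sum_add_distrib, sum_unifMass, ← Finset.mul_sum, p.sum_echo, mul_zero,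
    add_zero]

/-- The worker pool in which the response depends on the previous response of the same class
through a memory pattern, with strength `s`. -/
def pool (hs : s ∈ Set.Icc 0 (unifMass τ / 2)) : WorkerModel τ := fun _ _ b =>
  ⟨p.kernel s b, fun a => by
    have := p.half_unifMass_le_kernel hs b a
    have := @unifMass_pos τ
    linarith, p.sum_kernel s b⟩

variable (hs : s ∈ Set.Icc 0 (unifMass τ / 2))

theorem pool_mem_ownClassModels : p.pool hs ∈ ownClassModels τ := fun _ _ _ _ => rfl

theorem stepLaw_pool (t : Fin ℓ → Fin τ) (i : Fin ℓ) (y : Fin ℓ → Resp τ) :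
    stepLaw (p.pool hs) t i y = p.kernel s ((prevSame t i).map y) := rfl

/-- The memory of the response to `j` is uncorrelated with all the responses before the next object
of the class of `j`, since `cue` is orthogonal to constants and to `echo`. -/
theorem expect_cue_mul {t : Fin ℓ → Fin τ} {i j : Fin ℓ} (hj : prevSame t i = some j)
    {φ : (Fin ℓ → Resp τ) → ℝ} (hφ : DependsBelow i φ)
    (hφj : ∀ y v, φ (Function.update y j v) = φ y) :
    expect (p.pool hs) t (fun y => p.cue (y j) * φ y) = 0 := by
  have hji := lt_of_prevSame_eq_some hj
  rw [expect_eq_truncated (p.pool hs) t (n := i)]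
  · refine (sum_prod_mul_congr j (F' := fun _ => 0)
      (w := fun (k : Fin ℓ) y => if (k : ℕ) < i then stepLaw (p.pool hs) t k y (y k)
        else unifMass τ) (fun _ _ => rfl) ?_ ?_).trans (by simp)
    · -- before `i`, no object other than `j` has a response law that involves the response to `j`
      intro k hk y v
      by_cases hki : (k : ℕ) < i
      · have : prevSame t k ≠ some j := by
          intro h
          rw [prevSame_injective h hj] at hki
          exact lt_irrefl _ hki
        simp only [hki, if_true, stepLaw_pool]
        rw [map_update_of_ne this, Function.update_of_ne hk]
      · simp only [hki, if_false]
    · intro y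
      simp only [hφj, Fin.lt_def.1 hji, if_true, stepLaw_update _ t le_rfl, Function.update_self,
        mul_zero, Finset.sum_const_zero]
      simp only [stepLaw_pool, kernel]
      generalize s * ((prevSame t j).map y).elim 0 p.cue = x
      have : ∀ v, (unifMass τ + x * p.echo v) * (p.cue v * φ y) =
          unifMass τ * φ y * p.cue v + x * φ y * (p.cue v * p.echo v) := fun v => by ring
      simp only [this, Finset.sum_add_distrib, ← Finset.mul_sum, p.sum_cue,
        p.sum_cue_mul_echo, mul_zero, add_zero]
  · intro k hk y v
    have hjk : j ≠ k := fun h => absurd (Fin.lt_def.1 hji) (by rw [h]; omega)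
    simp only [Function.update_of_ne hjk, hφ k hk]

/-- Every response is uniform. -/
theorem expect_indicator (t : Fin ℓ → Fin τ) (i : Fin ℓ) (a : Resp τ) :
    expect (p.pool hs) t (fun y => if y i = a then 1 else 0) = unifMass τ := by
  have h := expect_indicator_mul (p.pool hs) t i a (φ := fun _ => 1) (fun _ _ _ _ => rfl)
  simp only [mul_one, stepLaw_pool, kernel] at h
  rw [h]
  cases hj : prevSame t i with
  | none =>
    have := expect_mul_left (p.pool hs) t (unifMass τ) fun _ => 1
    simpa [expect_one] using this
  | some j =>
    have h0 := expect_cue_mul p hs hj (φ := fun _ => 1) (fun _ _ _ _ => rfl) fun _ _ => rfl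
    have h1 : expect (p.pool hs) t (fun _ => unifMass τ * 1) = unifMass τ := by
      rw [expect_mul_left, expect_one, mul_one]
    have h2 := expect_mul_left (p.pool hs) t (s * p.echo a) fun y => p.cue (y j) * 1
    rw [h0, mul_zero] at h2
    have h3 := expect_add (p.pool hs) t (fun _ => unifMass τ * 1)
      (fun y => s * p.echo a * (p.cue (y j) * 1))
    rw [h1, h2, add_zero] at h3
    refine Eq.trans ?_ h3
    congr 1
    ext y
    simp only [Option.map_some, Option.elim_some]
    ring

theorem expect_apply (t : Fin ℓ → Fin τ) (i : Fin ℓ) (h : Resp τ → ℝ) :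
    expect (p.pool hs) t (fun y => h (y i)) = ∑ r, unifMass τ * h r := by
  have h1 : ∀ y : Fin ℓ → Resp τ, h (y i) = ∑ r, h r * if y i = r then 1 else 0 := by simp
  simp only [h1]
  rw [expect_sum]
  refine Finset.sum_congr rfl fun r _ => ?_
  rw [expect_mul_left, p.expect_indicator hs, mul_comm]

/-- Mutual information of two consecutive responses of the same class. -/
def pairInfo (s : ℝ) : ℝ :=
  ∑ r, unifMass τ * ∑ a, p.kernel s (some r) a * Real.log (p.kernel s (some r) a / unifMass τ)

theorem info_eq_pairInfo {t : Fin ℓ → Fin τ} {i j : Fin ℓ} (hj : prevSame t i = some j)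
    {S : Finset (Fin ℓ)} (hS : ∀ k ∈ S, k < i) (hjS : j ∈ S) :
    info (p.pool hs) t i S = p.pairInfo s := by
  set M := fun b : S → Resp τ => expect (p.pool hs) t (matchInd S b) with hM
  have hlaw : pairLaw (p.pool hs) t i S = fun a b => M b * p.kernel s (some (b ⟨j, hjS⟩)) a := by
    ext a b
    rw [pairLaw_eq_expect, expect_indicator_mul _ t i a (dependsBelow_matchInd hS b), hM, mul_comm,
      ← expect_mul_left]
    refine Finset.sum_congr rfl fun y _ => ?_
    by_cases hb : ∀ k : S, y k = b k
    · simp [stepLaw_pool, hj, ← hb ⟨j, hjS⟩]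
    · simp only [matchInd, hb, if_false, mul_zero]
  have hrow : ∀ a, ∑ b, M b * p.kernel s (some (b ⟨j, hjS⟩)) a = unifMass τ := by
    intro a
    rw [hM, sum_expect_matchInd_mul (p.pool hs) t S fun b => p.kernel s (some (b ⟨j, hjS⟩)) a,
      p.expect_apply hs t j fun r => p.kernel s (some r) a]
    have : ∀ r, unifMass τ * p.kernel s (some r) a =
        unifMass τ * unifMass τ + unifMass τ * s * p.echo a * p.cue r := fun r => by
      simp only [kernel, Option.elim_some]; ring
    simp only [this, Finset.sum_add_distrib, ← Finset.mul_sum, p.sum_cue, sum_unifMass]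
    ring
  have hcol : ∀ b, ∑ a, M b * p.kernel s (some (b ⟨j, hjS⟩)) a = M b := by
    intro b
    rw [← Finset.mul_sum, p.sum_kernel, mul_one]
  rw [info, hlaw, mutualInfo]
  simp only [hrow, hcol]
  rw [Finset.sum_comm]
  have hcell : ∀ b a, M b * p.kernel s (some (b ⟨j, hjS⟩)) a *
      Real.log (M b * p.kernel s (some (b ⟨j, hjS⟩)) a / (unifMass τ * M b)) =
      M b * (p.kernel s (some (b ⟨j, hjS⟩)) a *
        Real.log (p.kernel s (some (b ⟨j, hjS⟩)) a / unifMass τ)) := by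
    intro b a
    rcases eq_or_ne (M b) 0 with h | h
    · simp [h]
    · rw [mul_comm (unifMass τ), mul_div_mul_left _ _ h, mul_assoc]
  simp only [hcell, ← Finset.mul_sum]
  rw [hM, sum_expect_matchInd_mul (p.pool hs) t S fun b =>
      ∑ a, p.kernel s (some (b ⟨j, hjS⟩)) a *
        Real.log (p.kernel s (some (b ⟨j, hjS⟩)) a / unifMass τ),
    p.expect_apply hs t j fun r =>
      ∑ a, p.kernel s (some r) a * Real.log (p.kernel s (some r) a / unifMass τ), pairInfo]

/-- Earlier responses that do not include the previous one of the same class carry no information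
at all. -/
theorem info_eq_zero {t : Fin ℓ → Fin τ} {i j : Fin ℓ} (hj : prevSame t i = some j)
    {S : Finset (Fin ℓ)} (hS : ∀ k ∈ S, k < i) (hjS : j ∉ S) :
    info (p.pool hs) t i S = 0 := by
  have hlaw : pairLaw (p.pool hs) t i S =
      fun a b => unifMass τ * expect (p.pool hs) t (matchInd S b) := by
    ext a b
    have h0 := p.expect_cue_mul hs hj (dependsBelow_matchInd hS b) (matchInd_update hjS b)
    have h2 := expect_mul_left (p.pool hs) t (s * p.echo a)
      fun y => p.cue (y j) * matchInd S b y
    rw [h0, mul_zero] at h2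
    rw [pairLaw_eq_expect, expect_indicator_mul _ t i a (dependsBelow_matchInd hS b),
      ← expect_mul_left, ← add_zero (expect _ _ fun y => unifMass τ * matchInd S b y), ← h2,
      ← expect_add]
    refine Finset.sum_congr rfl fun y _ => ?_
    simp only [stepLaw_pool, kernel, hj, Option.map_some, Option.elim_some]
    ring
  rw [info, hlaw]
  exact mutualInfo_eq_zero_of_product sum_unifMass (sum_expect_matchInd _ t S)

theorem memoryQuality_pool (hℓ : 2 ≤ ℓ) :
    memoryQuality (p.pool hs) ℓ = 1 / 2 * p.pairInfo s := by
  have hlt : ∀ (t : Fin ℓ → Fin τ) (i : Fin ℓ), ∀ k ∈ (prev i).toFinset, k < i := by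
    intro t i k hk
    exact lt_of_prev_eq_some (Option.mem_toFinset.1 hk)
  have hlabel : ∀ t : {t : Fin ℓ → Fin τ // ¬ Function.Injective t},
      labelQuality (p.pool hs) t.1 = 1 / 2 * p.pairInfo s := by
    rintro ⟨t, ht⟩
    have hne : Nonempty {i : Fin ℓ // prevSame t i ≠ none} := by
      obtain ⟨i, k, hik, hne⟩ : ∃ i k, t k = t i ∧ k < i := by
        simp only [Function.Injective, not_forall] at ht
        obtain ⟨i, k, h, hne⟩ := ht
        rcases lt_or_gt_of_ne hne with h' | h'
        · exact ⟨k, i, h, h'⟩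
        · exact ⟨i, k, h.symm, h'⟩
      exact ⟨⟨i, fun h => prevSame_eq_none_iff.1 h k hne hik⟩⟩
    have h1 : ∀ i : {i : Fin ℓ // prevSame t i ≠ none},
        info (p.pool hs) t i (neighbors t i) = p.pairInfo s := by
      rintro ⟨i, hi⟩
      obtain ⟨j, hj⟩ := Option.ne_none_iff_exists'.1 hi
      refine p.info_eq_pairInfo hs hj ?_ ?_
      · intro k hk
        rcases Finset.mem_union.1 hk with h | h
        · exact hlt t i k h
        · exact lt_of_prevSame_eq_some (Option.mem_toFinset.1 h)
      · exact Finset.mem_union_right _ (Option.mem_toFinset.2 hj)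
    have h2 : ∀ q : {q : Fin ℓ × Fin ℓ // prevSame t q.1 ≠ none ∧ prevSame t q.1 ≠ prev q.1 ∧
        q.2 < q.1 ∧ q.2 ∉ neighbors t q.1},
        info (p.pool hs) t q.1.1 (insert q.1.2 (prev q.1.1).toFinset) = 0 := by
      rintro ⟨⟨i, k⟩, hi, hprev, hki, hk⟩
      obtain ⟨j, hj⟩ := Option.ne_none_iff_exists'.1 hi
      refine p.info_eq_zero hs hj ?_ ?_
      · intro m hm
        rcases Finset.mem_insert.1 hm with h | h
        · exact h ▸ hki
        · exact hlt t i m h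
      · intro hm
        rcases Finset.mem_insert.1 hm with h | h
        · exact hk (h ▸ Finset.mem_union_right _ (Option.mem_toFinset.2 hj))
        · exact hprev (hj.trans (Option.mem_toFinset.1 h).symm)
    rw [labelQuality]
    simp only [h1, h2, ciInf_const, Real.iSup_const_zero, sub_zero]
  -- without classes there is only the null response, and `cue` would vanish
  have hτ : 0 < τ := by
    obtain ⟨a, -⟩ := Function.ne_iff.1 p.cue_ne_zero
    by_contra h
    obtain rfl : τ = 0 := by omega
    refine p.cue_ne_zero (funext fun a => ?_)
    have h1 := p.sum_cue
    rw [Fintype.sum_option] at h1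
    cases a with
    | none => simpa using h1
    | some x => exact x.elim0
  have : Nonempty {t : Fin ℓ → Fin τ // ¬ Function.Injective t} := by
    refine ⟨⟨fun _ => ⟨0, hτ⟩, fun h => ?_⟩⟩
    have := @h ⟨0, by omega⟩ ⟨1, by omega⟩ rfl
    simp at this
  rw [memoryQuality]
  simp only [hlabel, ciInf_const]

theorem pairInfo_zero : p.pairInfo 0 = 0 := by
  simp [pairInfo, kernel, div_self (@unifMass_pos τ).ne']

theorem continuousOn_pairInfo : ContinuousOn p.pairInfo (Set.Icc 0 (unifMass τ / 2)) := by
  unfold pairInfo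
  have hk : ∀ r a, Continuous fun s => p.kernel s (some r) a := by
    intro r a
    unfold kernel
    fun_prop
  refine continuousOn_finsetSum _ fun r _ => continuousOn_const.mul ?_
  refine continuousOn_finsetSum _ fun a _ => (hk r a).continuousOn.mul ?_
  refine ContinuousOn.log ((hk r a).continuousOn.div_const _) fun s hs => ?_
  have h1 := p.half_unifMass_le_kernel hs (some r) a
  have h2 := @unifMass_pos τ
  exact (div_pos (by linarith) h2).ne'

/-- The information grows at least quadratically with the strength of the memory. -/
theorem exists_mul_sq_le_pairInfo :
    ∃ c > 0, ∀ s ∈ Set.Icc 0 (unifMass τ / 2), c * s ^ 2 ≤ p.pairInfo s := by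
  have hu := @unifMass_pos τ
  have sum_sq_pos : ∀ h : Resp τ → ℝ, h ≠ 0 → 0 < ∑ a, h a ^ 2 := by
    intro h hne
    obtain ⟨a, ha⟩ := Function.ne_iff.1 hne
    exact Finset.sum_pos' (fun _ _ => sq_nonneg _)
      ⟨a, Finset.mem_univ a, by have : h a ≠ 0 := ha
                                positivity⟩
  refine ⟨unifMass τ / 4 * ((∑ r, p.cue r ^ 2) * ∑ a, p.echo a ^ 2), ?_, fun s hs => ?_⟩
  · have := sum_sq_pos _ p.cue_ne_zero
    have := sum_sq_pos _ p.echo_ne_zero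
    positivity
  have hrow : ∀ r, s ^ 2 / 4 * (p.cue r ^ 2 * ∑ a, p.echo a ^ 2) ≤
      ∑ a, p.kernel s (some r) a * Real.log (p.kernel s (some r) a / unifMass τ) := by
    intro r
    have h0 : ∑ a, (p.kernel s (some r) a - unifMass τ) = 0 := by
      rw [Finset.sum_sub_distrib, p.sum_kernel, sum_unifMass, sub_self]
    have h1 : s ^ 2 / 4 * (p.cue r ^ 2 * ∑ a, p.echo a ^ 2) =
        ∑ a, (p.kernel s (some r) a - unifMass τ +
          (p.kernel s (some r) a - unifMass τ) ^ 2 / 4) := by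
      rw [Finset.sum_add_distrib, h0, zero_add, Finset.mul_sum, Finset.mul_sum]
      refine Finset.sum_congr rfl fun a _ => ?_
      simp only [kernel, Option.elim_some]
      ring
    rw [h1]
    refine Finset.sum_le_sum fun a _ => ?_
    have hk := p.half_unifMass_le_kernel hs (some r)
    refine sub_add_sq_le_mul_log_div (by linarith [hk a]) ?_ hu unifMass_le_one
    rw [← p.sum_kernel s (some r)]
    exact Finset.single_le_sum (fun b _ => by linarith [hk b]) (Finset.mem_univ a)
  calc unifMass τ / 4 * ((∑ r, p.cue r ^ 2) * ∑ a, p.echo a ^ 2) * s ^ 2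
      = ∑ r, unifMass τ * (s ^ 2 / 4 * (p.cue r ^ 2 * ∑ a, p.echo a ^ 2)) := by
        rw [← Finset.mul_sum, ← Finset.mul_sum, ← Finset.sum_mul]
        ring
    _ ≤ p.pairInfo s := Finset.sum_le_sum fun r _ => mul_le_mul_of_nonneg_left (hrow r) hu.le

/-- Every small quality is attained, for all `ℓ ≥ 2` at once, by a pool with memory pattern `p`. -/
theorem exists_pairInfo_eq : ∃ θ₀ > 0, ∀ θ ∈ Set.Ioo 0 θ₀,
    ∃ s ∈ Set.Icc 0 (unifMass τ / 2), 1 / 2 * p.pairInfo s = θ := by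
  have hu := @unifMass_pos τ
  obtain ⟨c, hc, hcs⟩ := p.exists_mul_sq_le_pairInfo
  refine ⟨1 / 2 * p.pairInfo (unifMass τ / 2), ?_, fun θ hθ => ?_⟩
  · have h1 := hcs (unifMass τ / 2) ⟨by linarith, le_rfl⟩
    have h2 : 0 < c * (unifMass τ / 2) ^ 2 := by positivity
    linarith
  · have h := intermediate_value_Icc (by linarith : (0 : ℝ) ≤ unifMass τ / 2)
      p.continuousOn_pairInfo
    have hθ2 : 2 * θ ∈ Set.Icc (p.pairInfo 0) (p.pairInfo (unifMass τ / 2)) :=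
      ⟨by rw [p.pairInfo_zero]; linarith [hθ.1], by linarith [hθ.2]⟩
    obtain ⟨s, hs, hsθ⟩ := h hθ2
    exact ⟨s, hs, by rw [hsθ]; ring⟩

end MemoryPattern

/-! ### Error probability and the two-class prior -/

section Decoding

variable {τ ℓ n : ℕ}

theorem sum_prod_columns {ι β : Type*} [Fintype ι] [DecidableEq ι] [Fintype β]
    (g : (ι → β) → ℝ) (n : ℕ) :
    ∑ Y : ι → Fin n → β, ∏ j, g (fun i => Y i j) = (∑ y, g y) ^ n := by
  rw [Fintype.sum_pow]
  exact (Equiv.piComm fun (_ : ι) (_ : Fin n) => β).sum_comp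
    fun Z : Fin n → ι → β => ∏ j, g (Z j)

/-- Probability of the response matrix `Y` when the labels are `t`. -/
def likelihood (Q : WorkerModel τ) (t : Fin ℓ → Fin τ) (Y : Fin ℓ → Fin n → Resp τ) : ℝ :=
  ∏ j, respProb Q t fun i => Y i j

/-- Probability of the labels `t` under the prior `P`. -/
def priorProb (P : stdSimplex ℝ (Fin τ)) (t : Fin ℓ → Fin τ) : ℝ := ∏ i, P.1 (t i)

theorem likelihood_nonneg (Q : WorkerModel τ) (t : Fin ℓ → Fin τ) (Y : Fin ℓ → Fin n → Resp τ) :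
    0 ≤ likelihood Q t Y := Finset.prod_nonneg fun _ _ => respProb_nonneg Q t _

theorem sum_likelihood (Q : WorkerModel τ) (t : Fin ℓ → Fin τ) :
    ∑ Y : Fin ℓ → Fin n → Resp τ, likelihood Q t Y = 1 := by
  simp only [likelihood, sum_prod_columns, sum_respProb, one_pow]

theorem priorProb_nonneg (P : stdSimplex ℝ (Fin τ)) (t : Fin ℓ → Fin τ) : 0 ≤ priorProb P t :=
  Finset.prod_nonneg fun i _ => P.2.1 (t i)

theorem sum_priorProb (P : stdSimplex ℝ (Fin τ)) : ∑ t : Fin ℓ → Fin τ, priorProb P t = 1 := by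
  simp only [priorProb, ← Fintype.sum_pow, P.2.2, one_pow]

open Classical in
theorem errorProb_add_success (Q : WorkerModel τ) (P : stdSimplex ℝ (Fin τ)) (Φ : Decoder τ ℓ n) :
    errorProb Q P Φ + ∑ Y : Fin ℓ → Fin n → Resp τ, ∑ t : Fin ℓ → Fin τ,
      (if Φ Y = Setoid.ker t then priorProb P t * likelihood Q t Y else 0) = 1 := by
  rw [Finset.sum_comm, errorProb, ← Finset.sum_add_distrib]
  refine Eq.trans ?_ (sum_priorProb (ℓ := ℓ) P)
  refine Finset.sum_congr rfl fun t _ => ?_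
  rw [Finset.mul_sum, ← Finset.sum_add_distrib]
  calc _ = ∑ Y : Fin ℓ → Fin n → Resp τ, priorProb P t * likelihood Q t Y := by
        refine Finset.sum_congr rfl fun Y _ => ?_
        by_cases h : Φ Y = Setoid.ker t <;> simp [h, priorProb, likelihood]
    _ = priorProb P t := by rw [← Finset.mul_sum, sum_likelihood, mul_one]

/-- The prior that picks one of the classes `c` and `d` with equal probability. -/
def twoClassPrior (c d : Fin τ) : stdSimplex ℝ (Fin τ) :=
  ⟨fun x => 1 / 2 * ((if x = c then 1 else 0) + if x = d then 1 else 0),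
    fun x => by positivity, by
      rw [← Finset.mul_sum, Finset.sum_add_distrib]
      simp
      norm_num⟩

/-- The labels `t` with the classes `c` and `d` interchanged at the object `i`. -/
def flipAt (c d : Fin τ) (i : Fin ℓ) (t : Fin ℓ → Fin τ) : Fin ℓ → Fin τ :=
  Function.update t i (Equiv.swap c d (t i))

theorem flipAt_self (c d : Fin τ) (i : Fin ℓ) (t : Fin ℓ → Fin τ) :
    flipAt c d i t i = Equiv.swap c d (t i) := Function.update_self _ _ _

theorem flipAt_of_ne (c d : Fin τ) {i k : Fin ℓ} (h : k ≠ i) (t : Fin ℓ → Fin τ) :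
    flipAt c d i t k = t k := Function.update_of_ne h _ _

theorem flipAt_involutive (c d : Fin τ) (i : Fin ℓ) : Function.Involutive (flipAt c d i) := by
  intro t
  simp [flipAt]

theorem priorProb_flipAt (c d : Fin τ) (i : Fin ℓ) (t : Fin ℓ → Fin τ) :
    priorProb (twoClassPrior c d) (flipAt c d i t) = priorProb (twoClassPrior c d) t := by
  refine Finset.prod_congr rfl fun k _ => ?_
  by_cases h : k = i
  · subst h
    simp only [flipAt_self, twoClassPrior, Equiv.swap_apply_eq_iff, Equiv.swap_apply_left,
      Equiv.swap_apply_right]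
    ring
  · rw [flipAt_of_ne c d h]

theorem eq_or_eq_of_priorProb_ne_zero {c d : Fin τ} {t : Fin ℓ → Fin τ}
    (h : priorProb (twoClassPrior c d) t ≠ 0) (k : Fin ℓ) : t k = c ∨ t k = d := by
  by_contra! hk
  refine h (Finset.prod_eq_zero (Finset.mem_univ k) ?_)
  simp [twoClassPrior, hk.1, hk.2]

theorem swap_ne_self_of_eq_or_eq {c d x : Fin τ} (hcd : c ≠ d) (hx : x = c ∨ x = d) :
    Equiv.swap c d x ≠ x := by
  rcases hx with rfl | rfl
  · simpa using hcd.symm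
  · simpa using hcd

/-- Among the labellings with classes `c` and `d` only, one with a given clustering is determined by
the class of a single object. -/
theorem eq_of_ker_eq {c d : Fin τ} {t t' : Fin ℓ → Fin τ} (ht : ∀ k, t k = c ∨ t k = d)
    (ht' : ∀ k, t' k = c ∨ t' k = d) (hker : Setoid.ker t = Setoid.ker t') {i : Fin ℓ}
    (hi : t i = t' i) : t = t' := by
  ext1 k
  have h : t k = t i ↔ t' k = t' i := by
    have := Setoid.ext_iff.1 hker k i
    rwa [Setoid.ker_def, Setoid.ker_def] at this
  have h1 := ht k
  have h2 := ht' k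
  have h3 := ht i
  have h4 := ht' i
  grind

/-! ### Changing one label -/

theorem le_prevSame_of_eq_off {t t' : Fin ℓ → Fin τ} {i k p : Fin ℓ} (h : ∀ j ≠ i, t' j = t j)
    (hk : k ≠ i) (hp : prevSame t k = some p) (hpi : p ≠ i) :
    ∃ q, prevSame t' k = some q ∧ p ≤ q := by
  obtain ⟨hpk, hpt, -⟩ := prevSame_eq_some_iff.1 hp
  have hpt' : t' p = t' k := by rw [h p hpi, h k hk, hpt]
  cases hq : prevSame t' k with
  | none => exact absurd hpt' (prevSame_eq_none_iff.1 hq p hpk)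
  | some q => exact ⟨q, rfl, (prevSame_eq_some_iff.1 hq).2.2 p hpk hpt'⟩

theorem prevSame_eq_of_eq_off {t t' : Fin ℓ → Fin τ} {i k : Fin ℓ} (h : ∀ j ≠ i, t' j = t j)
    (hk : k ≠ i) (h1 : prevSame t k ≠ some i) (h2 : prevSame t' k ≠ some i) :
    prevSame t' k = prevSame t k := by
  have h' : ∀ j ≠ i, t j = t' j := fun j hj => (h j hj).symm
  cases hp : prevSame t k with
  | some p =>
    have hpi : p ≠ i := fun e => h1 (e ▸ hp)
    obtain ⟨q, hq, hpq⟩ := le_prevSame_of_eq_off h hk hp hpi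
    have hqi : q ≠ i := fun e => h2 (e ▸ hq)
    obtain ⟨p', hp', hqp⟩ := le_prevSame_of_eq_off h' hk hq hqi
    obtain rfl : p = p' := Option.some_inj.1 (hp.symm.trans hp')
    rw [hq, le_antisymm hpq hqp]
  | none =>
    cases hq : prevSame t' k with
    | none => rfl
    | some q =>
      have hqi : q ≠ i := fun e => h2 (e ▸ hq)
      obtain ⟨p', hp', -⟩ := le_prevSame_of_eq_off h' hk hq hqi
      exact absurd (hp.symm.trans hp') (by simp)

/-- Changing the label of one object changes the response law of at most three objects: the object
itself and the next object of its old and of its new class. -/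
theorem pow_three_mul_respProb_le {Q : WorkerModel τ} {δ : ℝ} (hδ : 0 ≤ δ) (hδ1 : δ ≤ 1)
    (hQ : ∀ t a b y, δ ≤ (Q t a b).1 y) {t t' : Fin ℓ → Fin τ} {i : Fin ℓ}
    (h : ∀ j ≠ i, t' j = t j) (y : Fin ℓ → Resp τ) :
    δ ^ 3 * respProb Q t y ≤ respProb Q t' y := by
  have hcard : ∀ r : Fin ℓ → Fin τ,
      (Finset.univ.filter fun k => prevSame r k = some i).card ≤ 1 := by
    intro r
    refine Finset.card_le_one.2 fun k hk k' hk' => ?_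
    exact prevSame_injective (Finset.mem_filter.1 hk).2 (Finset.mem_filter.1 hk').2
  set B : Finset (Fin ℓ) := {i} ∪ Finset.univ.filter (fun k => prevSame t k = some i) ∪
    Finset.univ.filter (fun k => prevSame t' k = some i) with hB
  have hBcard : B.card ≤ 3 := by
    have h1 : B.card ≤ _ := Finset.card_union_le
      ({i} ∪ Finset.univ.filter fun k => prevSame t k = some i)
      (Finset.univ.filter fun k => prevSame t' k = some i)
    have h2 := Finset.card_union_le {i} (Finset.univ.filter fun k => prevSame t k = some i)
    have h3 := hcard t
    have h4 := hcard t'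
    rw [Finset.card_singleton] at h2
    omega
  calc δ ^ 3 * respProb Q t y
      ≤ δ ^ B.card * respProb Q t y :=
        mul_le_mul_of_nonneg_right (pow_le_pow_of_le_one hδ hδ1 hBcard) (respProb_nonneg Q t y)
    _ = ∏ k, (if k ∈ B then δ else 1) * stepLaw Q t k y (y k) := by
        rw [Finset.prod_mul_distrib, Finset.prod_ite_mem, Finset.univ_inter, Finset.prod_const]
        rfl
    _ ≤ ∏ k, stepLaw Q t' k y (y k) := by
        refine Finset.prod_le_prod (fun k _ => ?_) fun k _ => ?_
        · have := stepLaw_nonneg Q t k y (y k)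
          split_ifs <;> positivity
        · split_ifs with hk
          · calc δ * stepLaw Q t k y (y k) ≤ δ * 1 :=
                  mul_le_mul_of_nonneg_left (stepLaw_le_one Q t k y (y k)) hδ
              _ ≤ stepLaw Q t' k y (y k) := by rw [mul_one]; exact hQ _ _ _ _
          · have hk' : k ≠ i ∧ prevSame t k ≠ some i ∧ prevSame t' k ≠ some i := by
              simpa [hB, and_assoc] using hk
            rw [one_mul, stepLaw, stepLaw, h k hk'.1,
              prevSame_eq_of_eq_off h hk'.1 hk'.2.1 hk'.2.2]

theorem pow_mul_likelihood_le {Q : WorkerModel τ} {δ : ℝ} (hδ : 0 ≤ δ) (hδ1 : δ ≤ 1)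
    (hQ : ∀ t a b y, δ ≤ (Q t a b).1 y) {t t' : Fin ℓ → Fin τ} {i : Fin ℓ}
    (h : ∀ j ≠ i, t' j = t j) (Y : Fin ℓ → Fin n → Resp τ) :
    (δ ^ 3) ^ n * likelihood Q t Y ≤ likelihood Q t' Y := by
  have : (δ ^ 3) ^ n * likelihood Q t Y = ∏ j, δ ^ 3 * respProb Q t fun i => Y i j := by
    rw [Finset.prod_mul_distrib, Finset.prod_const, Finset.card_univ, Fintype.card_fin, likelihood]
  rw [this]
  exact Finset.prod_le_prod
    (fun j _ => mul_nonneg (by positivity) (respProb_nonneg Q t _))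
    fun j _ => pow_three_mul_respProb_le hδ hδ1 hQ h _

/-- Under the two-class prior every labelling competes with its `ℓ` single flips, each of which is
at least `δ ^ (3 * n)` times as likely. Hence no decoder is right with probability more than
`τ / (ℓ * δ ^ (3 * n))`. -/
theorem mul_one_sub_errorProb_le {Q : WorkerModel τ} {δ : ℝ} (hδ : 0 ≤ δ) (hδ1 : δ ≤ 1)
    (hQ : ∀ t a b y, δ ≤ (Q t a b).1 y) {c d : Fin τ} (hcd : c ≠ d) (hℓ : 0 < ℓ)
    (Φ : Decoder τ ℓ n) :
    ℓ * (δ ^ 3) ^ n * (1 - errorProb Q (twoClassPrior c d) Φ) ≤ τ := by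
  classical
  set P := twoClassPrior c d with hP
  have hw : ∀ (t : Fin ℓ → Fin τ) (Y : Fin ℓ → Fin n → Resp τ),
      0 ≤ priorProb P t * likelihood Q t Y := fun t Y =>
    mul_nonneg (priorProb_nonneg P t) (likelihood_nonneg Q t Y)
  rw [← errorProb_add_success Q P Φ, add_sub_cancel_left, Finset.mul_sum]
  have htotal : ∑ Y : Fin ℓ → Fin n → Resp τ, ∑ t : Fin ℓ → Fin τ,
      priorProb P t * likelihood Q t Y = 1 := by
    rw [Finset.sum_comm]
    simp only [← Finset.mul_sum, sum_likelihood, mul_one, sum_priorProb]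
  have hflip : ∀ (t : Fin ℓ → Fin τ) (Y : Fin ℓ → Fin n → Resp τ), priorProb P t ≠ 0 →
      ℓ * (δ ^ 3) ^ n * (priorProb P t * likelihood Q t Y) ≤
        ∑ t' : Fin ℓ → Fin τ, priorProb P t' * likelihood Q t' Y := by
    intro t Y ht
    -- a labelling of positive prior probability uses `c` and `d` only, so its flips are distinct
    have hinj : Function.Injective fun i => flipAt c d i t := by
      intro i j hij
      by_contra hne
      have := congrFun hij i
      simp only [flipAt_self, flipAt_of_ne c d hne] at this
      exact swap_ne_self_of_eq_or_eq hcd (eq_or_eq_of_priorProb_ne_zero ht i) this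
    calc ℓ * (δ ^ 3) ^ n * (priorProb P t * likelihood Q t Y)
        = ∑ _i : Fin ℓ, priorProb P t * ((δ ^ 3) ^ n * likelihood Q t Y) := by
          rw [Finset.sum_const, Finset.card_univ, Fintype.card_fin, nsmul_eq_mul]
          ring
      _ ≤ ∑ i : Fin ℓ, priorProb P (flipAt c d i t) * likelihood Q (flipAt c d i t) Y := by
          refine Finset.sum_le_sum fun i _ => ?_
          rw [hP, priorProb_flipAt]
          exact mul_le_mul_of_nonneg_left
            (pow_mul_likelihood_le hδ hδ1 hQ (fun j hj => flipAt_of_ne c d hj t) Y)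
            (priorProb_nonneg _ t)
      _ = ∑ t' ∈ Finset.univ.map ⟨_, hinj⟩, priorProb P t' * likelihood Q t' Y := by
          rw [Finset.sum_map]
          rfl
      _ ≤ _ := Finset.sum_le_sum_of_subset_of_nonneg (Finset.subset_univ _) fun t' _ _ => hw t' Y
  have hY : ∀ Y : Fin ℓ → Fin n → Resp τ,
      ℓ * (δ ^ 3) ^ n * ∑ t : Fin ℓ → Fin τ,
        (if Φ Y = Setoid.ker t then priorProb P t * likelihood Q t Y else 0) ≤
      τ * ∑ t' : Fin ℓ → Fin τ, priorProb P t' * likelihood Q t' Y := by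
    intro Y
    set G : Finset (Fin ℓ → Fin τ) :=
      Finset.univ.filter fun t => Φ Y = Setoid.ker t ∧ priorProb P t ≠ 0 with hG
    have hGcard : G.card ≤ τ := by
      calc G.card ≤ (Finset.univ : Finset (Fin τ)).card := by
            refine Finset.card_le_card_of_injOn (fun t => t ⟨0, hℓ⟩) (fun _ _ => by simp) ?_
            intro t ht t' ht' h
            simp only [hG, Finset.coe_filter, Finset.mem_univ, true_and,
              Set.mem_ofPred_eq] at ht ht'
            exact eq_of_ker_eq (eq_or_eq_of_priorProb_ne_zero ht.2)
              (eq_or_eq_of_priorProb_ne_zero ht'.2) (ht.1.symm.trans ht'.1) h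
        _ = τ := by simp
    have hsum : ∑ t : Fin ℓ → Fin τ,
        (if Φ Y = Setoid.ker t then priorProb P t * likelihood Q t Y else 0) =
        ∑ t ∈ G, priorProb P t * likelihood Q t Y := by
      rw [hG, Finset.sum_filter]
      refine Finset.sum_congr rfl fun t _ => ?_
      by_cases h0 : priorProb P t = 0 <;> simp [h0]
    rw [hsum, Finset.mul_sum]
    calc _ ≤ ∑ _t ∈ G, ∑ t' : Fin ℓ → Fin τ, priorProb P t' * likelihood Q t' Y :=
          Finset.sum_le_sum fun t ht => hflip t Y (Finset.mem_filter.1 ht).2.2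
      _ = G.card * ∑ t' : Fin ℓ → Fin τ, priorProb P t' * likelihood Q t' Y := by
          rw [Finset.sum_const, nsmul_eq_mul]
      _ ≤ _ := mul_le_mul_of_nonneg_right (by exact_mod_cast hGcard)
          (Finset.sum_nonneg fun t' _ => hw t' Y)
  refine (Finset.sum_le_sum fun Y _ => hY Y).trans ?_
  rw [← Finset.mul_sum, htotal, mul_one]

end Decoding

/-! ### Sample complexity -/

theorem ofReal_le_sampleComplexity {τ ℓ : ℕ} {𝒲 : Set (WorkerModel τ)} {θ ε x : ℝ}
    (h : ∀ (n : ℕ) (Φ : Decoder τ ℓ n), (∀ Q ∈ 𝒲, memoryQuality Q ℓ = θ →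
      ∀ P : stdSimplex ℝ (Fin τ), errorProb Q P Φ < ε) → x ≤ n) :
    ENNReal.ofReal x ≤ (sampleComplexity 𝒲 ℓ θ ε : ℝ≥0∞) := by
  have h1 : ((⌈x⌉₊ : ℕ) : ℕ∞) ≤ sampleComplexity 𝒲 ℓ θ ε := by
    refine le_iInf₂ fun n hn => ?_
    obtain ⟨Φ, hΦ⟩ := hn
    exact_mod_cast Nat.ceil_le.2 (h n Φ hΦ)
  calc ENNReal.ofReal x ≤ ((⌈x⌉₊ : ℕ) : ℝ≥0∞) := by
        rw [← ENNReal.ofReal_natCast]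
        exact ENNReal.ofReal_le_ofReal (Nat.le_ceil x)
    _ = (((⌈x⌉₊ : ℕ) : ℕ∞) : ℝ≥0∞) := by simp
    _ ≤ _ := ENat.toENNReal_le.2 h1

/-- If all response probabilities are at least `δ`, then `n` of order `log ℓ / log (1 / δ)` is
necessary, whatever error probability `ε < 1` is allowed. -/
theorem exists_log_le_sampleComplexity {τ : ℕ} (hτ : 2 ≤ τ) {𝒲 : Set (WorkerModel τ)} {θ : ℝ}
    (hθ : θ ∈ noisyQualities 𝒲) {ε : ℝ} (hε : ε < 1) :
    ∃ c : ℝ, 0 < c ∧ ∀ᶠ ℓ : ℕ in atTop,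
      ENNReal.ofReal (c * Real.log ℓ) ≤ (sampleComplexity 𝒲 ℓ θ ε : ℝ≥0∞) := by
  obtain ⟨δ', hδ', hev⟩ := hθ
  -- the minimum makes `log δ` negative
  set δ := min δ' (1 / 2) with hδdef
  have hδ : 0 < δ := lt_min hδ' (by norm_num)
  have hδ1 : δ < 1 := (min_le_right _ _).trans_lt (by norm_num)
  have hlogδ : Real.log δ < 0 := Real.log_neg hδ hδ1
  have hlarge : ∀ᶠ ℓ : ℕ in atTop, 2 * (Real.log τ - Real.log (1 - ε)) ≤ Real.log ℓ :=
    (Real.tendsto_log_atTop.comp tendsto_natCast_atTop_atTop).eventually_ge_atTop _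
  refine ⟨1 / (6 * -Real.log δ), by have : 0 < -Real.log δ := by linarith
                                    positivity, ?_⟩
  filter_upwards [hev, hlarge, eventually_gt_atTop 0] with ℓ hℓ hlog hℓ0
  obtain ⟨Q, hQ, hQδ, hQθ⟩ := hℓ
  refine ofReal_le_sampleComplexity fun n Φ hΦ => ?_
  have hcd : (⟨0, by omega⟩ : Fin τ) ≠ ⟨1, by omega⟩ := by simp [Fin.ext_iff]
  have herr := hΦ Q hQ hQθ (twoClassPrior ⟨0, by omega⟩ ⟨1, by omega⟩)
  have hmain := mul_one_sub_errorProb_le hδ.le hδ1.le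
    (fun t a b y => (min_le_left _ _).trans (hQδ t a b y)) hcd hℓ0 Φ
  have hℓr : (0 : ℝ) < ℓ := by exact_mod_cast hℓ0
  have hτr : (0 : ℝ) < τ := by exact_mod_cast (by omega : 0 < τ)
  have hε' : 0 < 1 - ε := by linarith
  have hprod : ℓ * (δ ^ 3) ^ n * (1 - ε) ≤ τ :=
    (mul_le_mul_of_nonneg_left (by linarith) (by positivity)).trans hmain
  have hlogs := Real.log_le_log (by positivity) hprod
  rw [Real.log_mul (by positivity) (by positivity), Real.log_mul (by positivity) (by positivity),
    Real.log_pow, Real.log_pow] at hlogs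
  push_cast at hlogs
  rw [div_mul_eq_mul_div, one_mul, div_le_iff₀ (by linarith)]
  linarith

/-! ### Weak memory -/

/-- An event has similar probabilities under a law `p` and the uniform law `q`, if the `χ²`
divergence of `p` from `q` is small. -/
theorem sum_mul_le_add_sqrt {Ω : Type*} [Fintype Ω] {p φ : Ω → ℝ} {q η : ℝ}
    (hcard : Fintype.card Ω * q = 1) (hp : ∑ x, p x = 1) (hφ : ∀ x, 0 ≤ φ x ∧ φ x ≤ 1)
    (hη : ∑ x, p x ^ 2 ≤ q * (1 + η)) :
    ∑ x, q * φ x ≤ ∑ x, p x * φ x + √η := by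
  have hsq : ∑ x, (q - p x) ^ 2 ≤ q * η := by
    have : ∀ x, (q - p x) ^ 2 = q * q - 2 * q * p x + p x ^ 2 := fun x => by ring
    simp only [this, Finset.sum_add_distrib, Finset.sum_sub_distrib, ← Finset.mul_sum, hp,
      Finset.sum_const, Finset.card_univ, nsmul_eq_mul, mul_one]
    rw [hcard]
    linarith
  have hφsq : ∑ x, φ x ^ 2 ≤ Fintype.card Ω := by
    calc ∑ x, φ x ^ 2 ≤ ∑ _x : Ω, (1 : ℝ) :=
          Finset.sum_le_sum fun x _ => pow_le_one₀ (hφ x).1 (hφ x).2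
      _ = _ := by simp
  have hCS : (∑ x, (q - p x) * φ x) ^ 2 ≤ η :=
    calc (∑ x, (q - p x) * φ x) ^ 2
        ≤ (∑ x, (q - p x) ^ 2) * ∑ x, φ x ^ 2 := Finset.sum_mul_sq_le_sq_mul_sq _ _ _
      _ ≤ q * η * Fintype.card Ω := by
          refine mul_le_mul hsq hφsq (Finset.sum_nonneg fun x _ => sq_nonneg _) ?_
          exact (Finset.sum_nonneg fun x _ => sq_nonneg _).trans hsq
      _ = η := by rw [mul_right_comm, mul_comm q, hcard, one_mul]
  have h := Real.le_sqrt_of_sq_le hCS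
  simp only [sub_mul, Finset.sum_sub_distrib] at h
  linarith

section

variable {τ ℓ n : ℕ}

open Classical in
/-- Flipping the label of one object changes the clustering, so that under the two-class prior no
clustering has probability more than one half. -/
theorem half_le_sum_priorProb {c d : Fin τ} (hcd : c ≠ d) (hℓ : 2 ≤ ℓ) (π : Setoid (Fin ℓ)) :
    1 / 2 ≤ ∑ t : Fin ℓ → Fin τ,
      priorProb (twoClassPrior c d) t * if π = Setoid.ker t then 0 else 1 := by
  set P := twoClassPrior c d with hP
  let i : Fin ℓ := ⟨0, by omega⟩
  let k : Fin ℓ := ⟨1, by omega⟩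
  have hki : k ≠ i := by simp [k, i, Fin.ext_iff]
  have hflip : ∑ t : Fin ℓ → Fin τ, priorProb P t * (if π = Setoid.ker t then 0 else 1) =
      ∑ t : Fin ℓ → Fin τ,
        priorProb P t * (if π = Setoid.ker (flipAt c d i t) then 0 else 1) := by
    rw [← Equiv.sum_comp (flipAt_involutive c d i).toPerm]
    refine Finset.sum_congr rfl fun t _ => ?_
    rw [Function.Involutive.coe_toPerm, hP, priorProb_flipAt]
  have hsum : (1 : ℝ) ≤ ∑ t : Fin ℓ → Fin τ,
      (priorProb P t * (if π = Setoid.ker t then 0 else 1) +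
        priorProb P t * (if π = Setoid.ker (flipAt c d i t) then 0 else 1)) := by
    refine (sum_priorProb (ℓ := ℓ) P).symm.trans_le ?_
    refine Finset.sum_le_sum fun t _ => ?_
    have h0 := priorProb_nonneg P t
    rcases eq_or_ne (priorProb P t) 0 with hz | hz
    · simp [hz]
    by_cases h1 : π = Setoid.ker t
    · have h2 : π ≠ Setoid.ker (flipAt c d i t) := by
        intro h2
        have h := Setoid.ext_iff.1 (h1.symm.trans h2) k i
        rw [Setoid.ker_def, Setoid.ker_def, flipAt_self, flipAt_of_ne c d hki] at h
        have hk := eq_or_eq_of_priorProb_ne_zero hz k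
        have hi := eq_or_eq_of_priorProb_ne_zero hz i
        rcases hk with hk | hk <;> rcases hi with hi | hi <;> simp [hk, hi, hcd, hcd.symm] at h
      simp [h1, h1 ▸ h2]
    · simp only [h1, if_false, mul_one]
      split_ifs <;> simp [h0]
  rw [Finset.sum_add_distrib, ← hflip] at hsum
  linarith

theorem card_words_mul (τ ℓ : ℕ) :
    (Fintype.card (Fin ℓ → Resp τ) : ℝ) * unifMass τ ^ ℓ = 1 := by
  have h : ((τ : ℝ) + 1) ≠ 0 := by positivity
  simp [unifMass, Resp, h]

namespace MemoryPattern

variable (p : MemoryPattern τ)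

/-- Under a memory of strength `s`, every word of `ℓ` responses has its probability under uniform
responses up to a relative error of order `s`. -/
theorem exists_abs_respProb_sub_le (ℓ : ℕ) : ∃ C > 0, ∀ s, ∀ hs : s ∈ Set.Icc 0 (unifMass τ / 2),
    ∀ (t : Fin ℓ → Fin τ) (y : Fin ℓ → Resp τ),
      |respProb (p.pool hs) t y - unifMass τ ^ ℓ| ≤ unifMass τ ^ ℓ * (C * s) := by
  have hu := @unifMass_pos τ
  -- the summand `1` keeps the constant positive for `ℓ = 0`
  refine ⟨ℓ / unifMass τ * Real.exp (ℓ / 2) + 1, by positivity, fun s hs t y => ?_⟩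
  set x : Fin ℓ → ℝ := fun k =>
    s * ((prevSame t k).map y).elim 0 p.cue * p.echo (y k) / unifMass τ with hx
  have hxle : ∀ k, ‖x k‖ ≤ s / unifMass τ := by
    intro k
    rw [hx, Real.norm_eq_abs, abs_div, abs_of_pos hu]
    exact div_le_div_of_nonneg_right (p.abs_perturbation_le hs.1 _ _) hu.le
  have hprod : respProb (p.pool hs) t y = unifMass τ ^ ℓ * ∏ k, (1 + x k) := by
    have : ∀ k, stepLaw (p.pool hs) t k y (y k) = unifMass τ * (1 + x k) := by
      intro k
      rw [p.stepLaw_pool, kernel, hx]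
      field_simp
    calc respProb (p.pool hs) t y = ∏ k, stepLaw (p.pool hs) t k y (y k) := rfl
      _ = _ := by simp only [this, Finset.prod_mul_distrib, Finset.prod_const, Finset.card_univ,
                    Fintype.card_fin]
  have hsum : ∑ k, ‖x k‖ ≤ ℓ * (s / unifMass τ) := by
    simpa using Finset.sum_le_sum fun k (_ : k ∈ Finset.univ) => hxle k
  have hz0 : 0 ≤ (ℓ : ℝ) * (s / unifMass τ) := by have := hs.1; positivity
  have hz1 : (ℓ : ℝ) * (s / unifMass τ) ≤ ℓ / 2 := by
    have : s / unifMass τ ≤ 1 / 2 := by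
      rw [div_le_iff₀ hu]
      linarith [hs.2]
    have := mul_le_mul_of_nonneg_left this (Nat.cast_nonneg (α := ℝ) ℓ)
    linarith
  -- `1 - z ≤ exp (-z)`, multiplied by `exp z`
  have hexp : ∀ z : ℝ, Real.exp z - 1 ≤ z * Real.exp z := by
    intro z
    have h1 := Real.add_one_le_exp (-z)
    have h2 : Real.exp (-z) * Real.exp z = 1 := by rw [← Real.exp_add]; simp
    nlinarith [Real.exp_pos z]
  have hdev : |∏ k, (1 + x k) - 1| ≤ (ℓ / unifMass τ * Real.exp (ℓ / 2) + 1) * s :=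
    calc |∏ k, (1 + x k) - 1| ≤ Real.exp (∑ k, ‖x k‖) - 1 :=
          Finset.norm_prod_one_add_sub_one_le Finset.univ x
      _ ≤ Real.exp (ℓ * (s / unifMass τ)) - 1 := by
          linarith [Real.exp_le_exp.2 hsum]
      _ ≤ ℓ * (s / unifMass τ) * Real.exp (ℓ * (s / unifMass τ)) := hexp _
      _ ≤ ℓ * (s / unifMass τ) * Real.exp (ℓ / 2) :=
          mul_le_mul_of_nonneg_left (Real.exp_le_exp.2 hz1) hz0
      _ = ℓ / unifMass τ * Real.exp (ℓ / 2) * s := by ring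
      _ ≤ _ := by linarith [hs.1]
  have : respProb (p.pool hs) t y - unifMass τ ^ ℓ = unifMass τ ^ ℓ * (∏ k, (1 + x k) - 1) := by
    rw [hprod]; ring
  rw [this, abs_mul, abs_of_pos (pow_pos hu ℓ)]
  exact mul_le_mul_of_nonneg_left hdev (pow_pos hu ℓ).le

/-- The `χ²` divergence of the response law of one worker from the uniform law is of order `s²`. -/
theorem exists_sum_respProb_sq_le (ℓ : ℕ) : ∃ C > 0, ∀ s, ∀ hs : s ∈ Set.Icc 0 (unifMass τ / 2),
    ∀ t : Fin ℓ → Fin τ,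
      ∑ y, respProb (p.pool hs) t y ^ 2 ≤ unifMass τ ^ ℓ * (1 + C * s ^ 2) := by
  obtain ⟨C, hC, hdev⟩ := p.exists_abs_respProb_sub_le ℓ
  refine ⟨C ^ 2, by positivity, fun s hs t => ?_⟩
  have hcard := card_words_mul τ ℓ
  set q := unifMass τ ^ ℓ
  have hle : ∀ y, respProb (p.pool hs) t y ^ 2 ≤
      2 * q * respProb (p.pool hs) t y + q * (q * (C ^ 2 * s ^ 2 - 1)) := by
    intro y
    have h := sq_le_sq' (neg_le_of_abs_le (hdev s hs t y)) (le_of_abs_le (hdev s hs t y))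
    nlinarith
  calc ∑ y, respProb (p.pool hs) t y ^ 2
      ≤ ∑ y : Fin ℓ → Resp τ,
          (2 * q * respProb (p.pool hs) t y + q * (q * (C ^ 2 * s ^ 2 - 1))) :=
        Finset.sum_le_sum fun y _ => hle y
    _ = q * (1 + C ^ 2 * s ^ 2) := by
        rw [Finset.sum_add_distrib, ← Finset.mul_sum, sum_respProb, Finset.sum_const,
          Finset.card_univ, nsmul_eq_mul, ← mul_assoc, hcard]
        ring

/-- With memory of strength `s`, no decoder does much better than guessing, as long as `n * s²` is
small. -/
theorem exists_half_sub_le_errorProb {c d : Fin τ} (hcd : c ≠ d) (hℓ : 2 ≤ ℓ) :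
    ∃ C > 0, ∀ s, ∀ hs : s ∈ Set.Icc 0 (unifMass τ / 2), ∀ (n : ℕ) (Φ : Decoder τ ℓ n),
      1 / 2 - √((1 + C * s ^ 2) ^ n - 1) ≤ errorProb (p.pool hs) (twoClassPrior c d) Φ := by
  classical
  obtain ⟨C, hC, hchi⟩ := p.exists_sum_respProb_sq_le ℓ
  refine ⟨C, hC, fun s hs n Φ => ?_⟩
  set P := twoClassPrior c d with hP
  set q := (unifMass τ ^ ℓ) ^ n with hq
  have hq0 : 0 < q := pow_pos (pow_pos unifMass_pos _) _
  have hcard : (Fintype.card (Fin ℓ → Fin n → Resp τ) : ℝ) * q = 1 := by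
    have h := congrArg (· ^ n) (card_words_mul τ ℓ)
    simp only [mul_pow, one_pow] at h
    rw [← h, hq]
    congr 1
    simp only [Fintype.card_pi, Finset.prod_const, Finset.card_univ, Fintype.card_fin, Nat.cast_pow]
    rw [← pow_mul, ← pow_mul, mul_comm]
  have hone : ∀ t : Fin ℓ → Fin τ,
      ∑ Y : Fin ℓ → Fin n → Resp τ, q * (if Φ Y = Setoid.ker t then 0 else 1) ≤
      ∑ Y : Fin ℓ → Fin n → Resp τ,
        likelihood (p.pool hs) t Y * (if Φ Y = Setoid.ker t then 0 else 1) +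
        √((1 + C * s ^ 2) ^ n - 1) := by
    intro t
    refine sum_mul_le_add_sqrt hcard (sum_likelihood _ t) (fun Y => ?_) ?_
    · split_ifs <;> simp
    · have h : ∑ Y : Fin ℓ → Fin n → Resp τ, likelihood (p.pool hs) t Y ^ 2 =
          (∑ y, respProb (p.pool hs) t y ^ 2) ^ n := by
        rw [← sum_prod_columns]
        simp only [likelihood, Finset.prod_pow]
      rw [h, add_sub_cancel, hq, ← mul_pow]
      exact pow_le_pow_left₀ (Finset.sum_nonneg fun y _ => sq_nonneg _) (hchi s hs t) n
  have hguess : (1 : ℝ) / 2 ≤ ∑ t : Fin ℓ → Fin τ, priorProb P t *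
      ∑ Y : Fin ℓ → Fin n → Resp τ, q * (if Φ Y = Setoid.ker t then 0 else 1) := by
    calc (1 : ℝ) / 2 = ∑ _Y : Fin ℓ → Fin n → Resp τ, q * (1 / 2) := by
          rw [Finset.sum_const, Finset.card_univ, nsmul_eq_mul, ← mul_assoc, hcard, one_mul]
      _ ≤ ∑ Y : Fin ℓ → Fin n → Resp τ, q * ∑ t : Fin ℓ → Fin τ,
            priorProb P t * (if Φ Y = Setoid.ker t then 0 else 1) :=
          Finset.sum_le_sum fun Y _ =>
            mul_le_mul_of_nonneg_left (half_le_sum_priorProb hcd hℓ (Φ Y)) hq0.le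
      _ = _ := by
          simp only [Finset.mul_sum]
          rw [Finset.sum_comm]
          exact Finset.sum_congr rfl fun t _ => Finset.sum_congr rfl fun Y _ => by ring
  have herr : errorProb (p.pool hs) P Φ = ∑ t : Fin ℓ → Fin τ, priorProb P t *
      ∑ Y : Fin ℓ → Fin n → Resp τ,
        likelihood (p.pool hs) t Y * (if Φ Y = Setoid.ker t then 0 else 1) := by
    unfold errorProb priorProb likelihood
    congr!
  have hall := Finset.sum_le_sum fun t (_ : t ∈ (Finset.univ : Finset (Fin ℓ → Fin τ))) =>
    mul_le_mul_of_nonneg_left (hone t) (priorProb_nonneg P t)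
  simp only [mul_add, Finset.sum_add_distrib] at hall
  rw [← herr, ← Finset.sum_mul, sum_priorProb, one_mul] at hall
  linarith

end MemoryPattern

end

theorem Ioo_subset_noisyQualities {τ : ℕ} (hτ : 2 ≤ τ) {𝒲 : Set (WorkerModel τ)}
    (h𝒲 : ownClassModels τ ⊆ 𝒲) : ∃ θ₀ > 0, Set.Ioo 0 θ₀ ⊆ noisyQualities 𝒲 := by
  obtain ⟨p⟩ := nonempty_memoryPattern hτ
  obtain ⟨θ₀, hθ₀, h⟩ := p.exists_pairInfo_eq
  refine ⟨θ₀, hθ₀, fun θ hθ => ?_⟩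
  obtain ⟨s, hs, hsθ⟩ := h θ hθ
  refine ⟨unifMass τ / 2, half_pos unifMass_pos, ?_⟩
  filter_upwards [eventually_ge_atTop 2] with ℓ hℓ
  exact ⟨p.pool hs, h𝒲 (p.pool_mem_ownClassModels hs),
    fun _ _ b y => p.half_unifMass_le_kernel hs b y, (p.memoryQuality_pool hs hℓ).trans hsθ⟩

/-- A pool of quality `θ` with a memory pattern has strength of order `√θ`, and `n` workers only
reveal something about the clustering when `n` is at least of order `1 / θ`. -/
theorem exists_inv_le_sampleComplexity {τ : ℕ} (hτ : 2 ≤ τ) {𝒲 : Set (WorkerModel τ)}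
    (h𝒲 : ownClassModels τ ⊆ 𝒲) {ℓ : ℕ} (hℓ : 2 ≤ ℓ) {ε : ℝ} (hε : ε < 1 / 2) :
    ∃ c : ℝ, 0 < c ∧ ∀ᶠ θ : ℝ in 𝓝[>] 0,
      ENNReal.ofReal (c * θ⁻¹) ≤ (sampleComplexity 𝒲 ℓ θ ε : ℝ≥0∞) := by
  obtain ⟨p⟩ := nonempty_memoryPattern hτ
  have hcd : (⟨0, by omega⟩ : Fin τ) ≠ ⟨1, by omega⟩ := by simp [Fin.ext_iff]
  obtain ⟨θ₀, hθ₀, hattain⟩ := p.exists_pairInfo_eq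
  obtain ⟨b, hb, hquad⟩ := p.exists_mul_sq_le_pairInfo
  obtain ⟨C, hC, herr⟩ := p.exists_half_sub_le_errorProb hcd hℓ
  set γ := 1 / 2 - ε with hγdef
  have hγ : 0 < γ := by linarith
  have hlog : 0 < Real.log (1 + γ ^ 2) := Real.log_pos (by nlinarith)
  refine ⟨Real.log (1 + γ ^ 2) * b / (2 * C), by positivity, ?_⟩
  filter_upwards [Ioo_mem_nhdsGT hθ₀] with θ hθ
  obtain ⟨s, hs, hsθ⟩ := hattain θ hθ
  refine ofReal_le_sampleComplexity fun n Φ hΦ => ?_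
  have hlt := (herr s hs n Φ).trans_lt (hΦ (p.pool hs) (h𝒲 (p.pool_mem_ownClassModels hs))
    ((p.memoryQuality_pool hs hℓ).trans hsθ) _)
  have h1 : γ ^ 2 < (1 + C * s ^ 2) ^ n - 1 := (Real.lt_sqrt hγ.le).1 (by linarith)
  have h2 : (1 + C * s ^ 2) ^ n ≤ Real.exp (n * (C * s ^ 2)) := by
    rw [Real.exp_nat_mul]
    refine pow_le_pow_left₀ (by positivity) ?_ n
    linarith [Real.add_one_le_exp (C * s ^ 2)]
  have h3 : Real.log (1 + γ ^ 2) ≤ n * (C * s ^ 2) :=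
    (Real.log_le_iff_le_exp (by positivity)).2 (by linarith)
  have h4 : b * s ^ 2 ≤ 2 * θ := by linarith [hquad s hs]
  have h5 : Real.log (1 + γ ^ 2) * b ≤ n * C * (2 * θ) := by
    calc Real.log (1 + γ ^ 2) * b ≤ n * (C * s ^ 2) * b := mul_le_mul_of_nonneg_right h3 hb.le
      _ = n * C * (b * s ^ 2) := by ring
      _ ≤ n * C * (2 * θ) := mul_le_mul_of_nonneg_left h4 (by positivity)
  have hθ0 := hθ.1
  rw [← div_eq_mul_inv, div_div, div_le_iff₀ (by positivity)]
  linarith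

end CrowdMemory

end

theorem mainTheorem8 (τ : ℕ) (hτ : 2 ≤ τ) (𝒲 : Set (CrowdMemory.WorkerModel τ))
    (h𝒲 : CrowdMemory.ownClassModels τ ⊆ 𝒲) :
    -- fixed memory quality, growing number of objects
    ((∃ θ₀ > 0, Set.Ioo 0 θ₀ ⊆ CrowdMemory.noisyQualities 𝒲) ∧
      ∀ θ ∈ CrowdMemory.noisyQualities 𝒲, 0 < θ → ∀ ε : ℝ, 0 < ε → ε < 1 →
        ∃ c : ℝ, 0 < c ∧ ∀ᶠ ℓ : ℕ in atTop,
          ENNReal.ofReal (c * Real.log ℓ) ≤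
            (CrowdMemory.sampleComplexity 𝒲 ℓ θ ε : ℝ≥0∞)) ∧
    -- fixed number of objects, vanishing memory quality
    (∀ ℓ : ℕ, 2 ≤ ℓ → ∀ ε : ℝ, 0 < ε → ε < 1 / 2 →
      ∃ c : ℝ, 0 < c ∧ ∀ᶠ θ : ℝ in 𝓝[>] 0,
        ENNReal.ofReal (c * θ⁻¹) ≤ (CrowdMemory.sampleComplexity 𝒲 ℓ θ ε : ℝ≥0∞)) :=
  ⟨⟨CrowdMemory.Ioo_subset_noisyQualities hτ h𝒲,
      fun _ hθ _ _ _ hε => CrowdMemory.exists_log_le_sampleComplexity hτ hθ hε⟩,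
    fun _ hℓ _ _ hε => CrowdMemory.exists_inv_le_sampleComplexity hτ h𝒲 hℓ hε⟩
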